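/- Let $1\le\mu$ and $0\le N\le\mu$ be integers, let $\sigma,E_s,N_0>0$, and let $V_{i,1},V_{i,2}\ge 0$ ($i=1,\dots,\mu$) be such that at least one of $V_{i,1},V_{i,2}$ vanishes for each $i>N$. Let $\phi_{i,1},\phi_{i,2}$ be uniform on $[0,2\pi)$ and $X_i,Y_i\sim\mathcal N(0,\sigma^2)$ ($i=1,\dots,\mu$), all of these random variables being mutually independent. Consider the MTW (Multi-cluster Two-Wave) fading channel with cluster amplitudes $$Z_i=V_{i,1}e^{j\phi_{i,1}}+V_{i,2}e^{j\phi_{i,2}}+X_i+jY_i ,\qquad j=\sqrt{-1},$$ received power $W=\sum_{i=1}^{\mu}|Z_i|^2$, received SNR $\gamma=W E_s/N_0$ and average SNR $\overline\gamma=E[\gamma]$. Put $$K=\frac{\sum_{i=1}^{\mu}(V_{i,1}^2+V_{i,2}^2)}{2\sigma^2\mu},\qquad \Delta_i=\frac{2V_{i,1}V_{i,2}}{\sum_{k=1}^{\mu}(V_{k,1}^2+V_{k,2}^2)}\quad(1\le i\le N),$$ with $\Delta_i=0$ if all $V_{k,1},V_{k,2}$ vanish. For $r\in\mathbb N=\{0,1,2,\dots\}$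 let $\tau(r,N)$ be the set of $N$-tuples $(r_1,\dots,r_N)\in\mathbb N^N$ with $\sum_{i=1}^N r_i=r$, and for $\nu\in\mathbb Z$ let $I_\nu$ be the modified Bessel function of the first kind of order $\nu$, $I_\nu(z)=\sum_{k\ge 0}\frac{(z/2)^{2k+\nu}}{k!\,\Gamma(\nu+k+1)}$, where $1/\Gamma$ is $0$ at the poles of $\Gamma$. Then for every $n\in\mathbb N$ and every $s\in\mathbb C$ with $\operatorname{Re}s<\mu(1+K)/\overline\gamma$, the random variable $\gamma^n e^{s\gamma}$ is integrable and (with $0^0=1$) $$E\left[\gamma^n e^{s\gamma}\right]=\overline\gamma^{\,n}\,\Gamma(\mu+n)\exp\left(\frac{\mu K\overline\gamma s}{\mu(1+K)-\overline\gamma s}\right)\sum_{q=0}^{n}\binom nq\frac{(\mu K)^q}{\Gamma(\mu+q)}\,\frac{(\mu(1+K))^{\mu+q}}{(\mu(1+K)-\overline\gamma s)^{\mu+q+n}}\;S_q(s),$$ $$S_q(s)=\sum_{r=0}^{q}\binom qr r!\sum_{(r_1,\dots,r_N)\in\tau(r,N)}\ \prod_{i=1}^{N}\left[\frac{1}{r_i!}\left(\frac{\Delta_i}{2}\right)^{r_i}\sum_{l=0}^{r_i}\binom{r_i}{l}\,I_{2l-r_i}\left(\frac{\mu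 K\Delta_i\overline\gamma s}{\mu(1+K)-\overline\gamma s}\right)\right].$$ -/

import Mathlib

open MeasureTheory ProbabilityTheory

namespace MTW

noncomputable section

/-- The modified Bessel function of the first kind `I_ν(z)` of integer order `ν`, as the power
series `∑ k, (z/2)^(2k+ν) / (k! Γ(ν+k+1))`. A term in which `ν+k+1` is a pole of `Γ` is zero:
Mathlib's `Γ` is `0` there, and division by `0` gives `0`, which is the value of `1/Γ`. -/
def besselI (ν : ℤ) (z : ℂ) : ℂ :=
  ∑' k : ℕ, (z / 2) ^ (2 * (k : ℤ) + ν) /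
    ((Nat.factorial k : ℂ) * Complex.Gamma ((ν : ℂ) + (k : ℂ) + 1))

/-- The random variables of an MTW channel with `μ` clusters: the phases `φ i k` of the two
specular waves of each cluster are uniform on `[0, 2π)`, the diffuse in-phase and quadrature
components `X i`, `Y i` are centred Gaussian of variance `σ ^ 2`, and all of them are mutually
independent. -/
structure IsMTWChannel {Ω : Type*} [MeasurableSpace Ω] (P : Measure Ω) {μ : ℕ} (σ : ℝ)
    (φ : Fin μ → Fin 2 → Ω → ℝ) (X Y : Fin μ → Ω → ℝ) : Prop where
  phase_law : ∀ i k, HasLaw (φ i k) (cond volume (Set.Ico 0 (2 * Real.pi))) P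
  inPhase_law : ∀ i, HasLaw (X i) (gaussianReal 0 (Real.toNNReal (σ ^ 2))) P
  quadrature_law : ∀ i, HasLaw (Y i) (gaussianReal 0 (Real.toNNReal (σ ^ 2))) P
  indep : iIndepFun (fun j : (Fin μ × Fin 2) ⊕ (Fin μ ⊕ Fin μ) =>
    Sum.elim (fun p : Fin μ × Fin 2 => φ p.1 p.2) (Sum.elim X Y) j) P

/-- Complex baseband amplitude of cluster `i`:
`Z_i = V_{i,1} e^{j φ_{i,1}} + V_{i,2} e^{j φ_{i,2}} + X_i + j Y_i`. -/
def clusterAmplitude {Ω : Type*} {μ : ℕ} (V : Fin μ → Fin 2 → ℝ)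
    (φ : Fin μ → Fin 2 → Ω → ℝ) (X Y : Fin μ → Ω → ℝ) (i : Fin μ) (ω : Ω) : ℂ :=
  (V i 0 : ℂ) * Complex.exp (Complex.I * (φ i 0 ω : ℂ)) +
    (V i 1 : ℂ) * Complex.exp (Complex.I * (φ i 1 ω : ℂ)) +
    ((X i ω : ℂ) + Complex.I * (Y i ω : ℂ))

/-- Total received power `W = ∑ i, |Z_i|²`. -/
def power {Ω : Type*} {μ : ℕ} (V : Fin μ → Fin 2 → ℝ)
    (φ : Fin μ → Fin 2 → Ω → ℝ) (X Y : Fin μ → Ω → ℝ) (ω : Ω) : ℝ :=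
  ∑ i, ‖clusterAmplitude V φ X Y i ω‖ ^ 2

/-- Received signal-to-noise ratio `γ = W E_s / N_0`. -/
def snr {Ω : Type*} {μ : ℕ} (V : Fin μ → Fin 2 → ℝ)
    (φ : Fin μ → Fin 2 → Ω → ℝ) (X Y : Fin μ → Ω → ℝ) (Es N0 : ℝ) (ω : Ω) : ℝ :=
  power V φ X Y ω * Es / N0

/-- `K = (∑ i, (V_{i,1}² + V_{i,2}²)) / (2 σ² μ)`. -/
def paramK {μ : ℕ} (V : Fin μ → Fin 2 → ℝ) (σ : ℝ) : ℝ :=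
  (∑ i, (V i 0 ^ 2 + V i 1 ^ 2)) / (2 * σ ^ 2 * (μ : ℝ))

/-- `Δ_i = 2 V_{i,1} V_{i,2} / ∑ j, (V_{j,1}² + V_{j,2}²)`, read as `0` if there is no specular
wave at all. -/
def paramDelta {μ : ℕ} (V : Fin μ → Fin 2 → ℝ) (i : Fin μ) : ℝ :=
  2 * V i 0 * V i 1 / ∑ j, (V j 0 ^ 2 + V j 1 ^ 2)

/-- The generalized moment generating function `E[γ^n e^{γ s}]` at a complex `s`. -/
def generalizedMGF {Ω : Type*} [MeasurableSpace Ω] (P : Measure Ω) (γ : Ω → ℝ) (n : ℕ)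
    (s : ℂ) : ℂ :=
  ∫ ω, (γ ω : ℂ) ^ n * Complex.exp ((γ ω : ℂ) * s) ∂P

end

end MTW

/-! Condition on the phases. The power is then a noncentral chi-square variable whose law depends on
the phases only through the specular power `M`, and its moment generating function is `(1 - 2vt)⁻ᵏ
exp (M t / (1 - 2vt))` with `v = σ²` and `k = μ` (`integral_cexp_mul_sum_sq_norm`). Its `n`-th
derivative in `t`, which is the conditional generalized moment, is the exponential times a
polynomial in `M` (`hasDerivAt_mgfDerivClosedForm`).

It remains to average over the phases. With `S` the sum of all squared wave amplitudes, `M = S (1 +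
∑ Δ_i cos θ_i)`, where the phase differences `θ_i` are again independent and uniform. The binomial
and multinomial theorems split `M ^ q` times the exponential into products with one factor per
cluster. Each factor is a one-dimensional integral of `cos ^ r * exp (z cos)`, a sum of Fourier
coefficients of `exp (z cos)`, which are Bessel functions
(`integral_cexp_int_mul_mul_cexp_mul_cos`).

The case `n = 1`, `t = 0` gives the mean, which translates `σ²`, `E_s / N_0` into `K` and the
average SNR. -/

/-! ### Gaussian integrals of a complex quadratic exponential. -/

lemma integrable_cexp_mul_add_sq_gaussianReal {v : NNReal} (hv : v ≠ 0) {z : ℂ}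
    (hz : z.re < 1 / (2 * v)) (x : ℝ) :
    Integrable (fun y : ℝ => Complex.exp (z * (x + y) ^ 2)) (gaussianReal 0 v) := by
  -- This is the coefficient of `y ^ 2` once the exponent `-y² / (2v)` of the density is absorbed.
  have hb : (z - (2 * (v : ℂ))⁻¹).re < 0 := by
    have : (z - (2 * (v : ℂ))⁻¹).re = z.re - (2 * v)⁻¹ := by
      rw [Complex.sub_re]; norm_cast
    rw [this]; simpa using hz
  rw [gaussianReal_of_var_ne_zero _ hv, integrable_withDensity_iff_integrable_smul' (by fun_prop)
    (by simp [gaussianPDF])]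
  have := (integrable_cexp_quadratic' hb (2 * z * x) (z * x ^ 2)).const_mul
    ((√(2 * Real.pi * v) : ℝ) : ℂ)⁻¹
  refine this.congr (ae_of_all _ fun y => ?_)
  simp only [toReal_gaussianPDF, gaussianPDFReal, Complex.real_smul]
  push_cast
  rw [mul_assoc (_⁻¹), ← Complex.exp_add]
  congr 2
  ring

/-- The constant is a complex square root whose branch never matters: the in-phase and quadrature
parts of a cluster each contribute one `C`, so only `C ^ 2` survives. -/
lemma exists_integral_cexp_mul_add_sq_gaussianReal {v : NNReal} (hv : v ≠ 0) {z : ℂ}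
    (hz : z.re < 1 / (2 * v)) :
    ∃ C : ℂ, C ^ 2 = (1 - 2 * v * z)⁻¹ ∧ ∀ x : ℝ,
      ∫ y : ℝ, Complex.exp (z * (x + y) ^ 2) ∂(gaussianReal 0 v) =
        C * Complex.exp (z * x ^ 2 / (1 - 2 * v * z)) := by
  have hb : (z - (2 * (v : ℂ))⁻¹).re < 0 := by
    have : (z - (2 * (v : ℂ))⁻¹).re = z.re - (2 * v)⁻¹ := by
      rw [Complex.sub_re]; norm_cast
    rw [this]; simpa using hz
  have hb0 : (z - (2 * (v : ℂ))⁻¹) ≠ 0 := fun h => by rw [h] at hb; simp at hb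
  have hv' : (v : ℂ) ≠ 0 := by simpa using hv
  have hbeq : (z - (2 * (v : ℂ))⁻¹) = -(1 - 2 * v * z) / (2 * v) := by field_simp; ring
  have h1 : (1 - 2 * (v : ℂ) * z) ≠ 0 := fun h => hb0 (by rw [hbeq, h]; simp)
  refine ⟨((√(2 * Real.pi * v) : ℝ) : ℂ)⁻¹ *
    (Real.pi / -(z - (2 * (v : ℂ))⁻¹)) ^ (1 / 2 : ℂ), ?_, fun x => ?_⟩
  · rw [mul_pow, ← Complex.cpow_nat_mul, inv_pow]
    have : ((√(2 * Real.pi * v) : ℝ) : ℂ) ^ 2 = 2 * Real.pi * v := by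
      rw [← Complex.ofReal_pow, Real.sq_sqrt (by positivity)]; push_cast; ring
    rw [this, hbeq, neg_div, neg_neg]
    have hpi : (Real.pi : ℂ) ≠ 0 := by simp [Real.pi_ne_zero]
    norm_num
    field_simp
  · rw [integral_gaussianReal_eq_integral_smul hv]
    calc _ = ∫ y : ℝ, ((√(2 * Real.pi * v) : ℝ) : ℂ)⁻¹ *
          Complex.exp ((z - (2 * (v : ℂ))⁻¹) * y ^ 2 + 2 * z * x * y + z * x ^ 2) := by
          congr with y
          simp only [gaussianPDFReal, Complex.real_smul]
          push_cast
          rw [mul_assoc (_⁻¹), ← Complex.exp_add]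
          congr 2
          ring
      _ = _ := by
          rw [integral_const_mul, integral_cexp_quadratic hb, mul_assoc (_⁻¹)]
          congr 3
          rw [hbeq]
          -- Eliminating `z` in favour of `D` makes the denominator atomic for `field_simp`.
          obtain ⟨D, hD⟩ : ∃ D, D = 1 - 2 * (v : ℂ) * z := ⟨_, rfl⟩
          have hzD : z = (1 - D) / (2 * v) := by rw [hD]; field_simp; ring
          rw [← hD] at h1 ⊢
          rw [hzD]
          field_simp
          ring

lemma Complex.sq_norm_add_add_I_mul (m : ℂ) (x y : ℝ) :
    ‖m + (x + Complex.I * y)‖ ^ 2 = (m.re + x) ^ 2 + (m.im + y) ^ 2 := by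
  rw [Complex.sq_norm, Complex.normSq_apply]
  simp
  ring

/-! ### Moment generating function of a noncentral chi-square variable. -/

section NoncentralChiSquare

variable {ι : Type*} [Fintype ι] {v : NNReal} {z : ℂ}

lemma cexp_mul_sum_sq_norm (z : ℂ) (m : ι → ℂ) (p : (ι → ℝ) × (ι → ℝ)) :
    Complex.exp (z * ((∑ i, ‖m i + (p.1 i + Complex.I * p.2 i)‖ ^ 2 : ℝ) : ℂ)) =
      (∏ i, Complex.exp (z * ((m i).re + p.1 i) ^ 2)) *
        ∏ i, Complex.exp (z * ((m i).im + p.2 i) ^ 2) := by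
  simp_rw [Complex.sq_norm_add_add_I_mul]
  rw [← Complex.exp_sum, ← Complex.exp_sum, ← Complex.exp_add, ← Finset.mul_sum, ← Finset.mul_sum,
    Finset.sum_add_distrib]
  push_cast
  ring_nf

lemma integrable_cexp_mul_sum_sq_norm (hv : v ≠ 0) (hz : z.re < 1 / (2 * v)) (m : ι → ℂ) :
    Integrable (fun p : (ι → ℝ) × (ι → ℝ) =>
      Complex.exp (z * ((∑ i, ‖m i + (p.1 i + Complex.I * p.2 i)‖ ^ 2 : ℝ) : ℂ)))
      ((Measure.pi fun _ => gaussianReal 0 v).prod (Measure.pi fun _ => gaussianReal 0 v)) := by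
  simp_rw [cexp_mul_sum_sq_norm]
  exact (Integrable.fintype_prod fun i =>
    integrable_cexp_mul_add_sq_gaussianReal hv hz (m i).re).mul_prod
    (Integrable.fintype_prod fun i => integrable_cexp_mul_add_sq_gaussianReal hv hz (m i).im)

lemma integral_cexp_mul_sum_sq_norm (hv : v ≠ 0) (hz : z.re < 1 / (2 * v)) (m : ι → ℂ) :
    ∫ p : (ι → ℝ) × (ι → ℝ),
      Complex.exp (z * ((∑ i, ‖m i + (p.1 i + Complex.I * p.2 i)‖ ^ 2 : ℝ) : ℂ))
      ∂((Measure.pi fun _ => gaussianReal 0 v).prod (Measure.pi fun _ => gaussianReal 0 v)) =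
    ((1 - 2 * v * z)⁻¹) ^ Fintype.card ι *
      Complex.exp ((∑ i, ‖m i‖ ^ 2 : ℝ) * z * (1 - 2 * v * z)⁻¹) := by
  simp_rw [cexp_mul_sum_sq_norm]
  obtain ⟨C, hC, h⟩ := exists_integral_cexp_mul_add_sq_gaussianReal hv hz
  rw [integral_prod_mul (fun x : ι → ℝ => ∏ i, Complex.exp (z * ((m i).re + x i) ^ 2))
      (fun x : ι → ℝ => ∏ i, Complex.exp (z * ((m i).im + x i) ^ 2)),
    integral_fintype_prod_eq_prod (fun i (x : ℝ) => Complex.exp (z * ((m i).re + x) ^ 2)),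
    integral_fintype_prod_eq_prod (fun i (x : ℝ) => Complex.exp (z * ((m i).im + x) ^ 2))]
  simp_rw [h, Finset.prod_mul_distrib, ← Complex.exp_sum, Finset.prod_const, Finset.card_univ]
  rw [mul_mul_mul_comm, ← mul_pow, ← Complex.exp_add, ← sq, hC, ← Finset.sum_add_distrib]
  congr 2
  push_cast
  rw [Finset.sum_mul, Finset.sum_mul]
  refine Finset.sum_congr rfl fun i _ => ?_
  rw [← Complex.ofReal_pow ‖m i‖, Complex.sq_norm, Complex.normSq_apply]
  push_cast
  ring

end NoncentralChiSquare

/-! ### Derivatives of the noncentral chi-square transform. -/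

/-- The value at `t` of the `n`-th derivative of `t ↦ (1 - A t)⁻ᵏ exp (B t / (1 - A t))`. -/
noncomputable def mgfDerivClosedForm (k : ℕ) (A B : ℂ) (n : ℕ) (t : ℂ) : ℂ :=
  Complex.exp (B * t * (1 - A * t)⁻¹) * ∑ q ∈ Finset.range (n + 1),
    (n.choose q : ℂ) * (Complex.Gamma ((k : ℂ) + n) / Complex.Gamma ((k : ℂ) + q)) *
      A ^ (n - q) * B ^ q * ((1 - A * t)⁻¹) ^ (k + q + n)

/-- Coefficient comparison for one differentiation: the first term comes from differentiating the
power of `(1 - A t)⁻¹`, the second from the exponential. It follows from Pascal's rule, `Γ(x+1) = x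
Γ(x)` and `(q+1) C(n,q+1) = (n-q) C(n,q)`. -/
lemma choose_mul_Gamma_div_Gamma_recursion {k : ℕ} (hk : 0 < k) (n q : ℕ) :
    ((n + 1).choose (q + 1) : ℂ) *
        (Complex.Gamma ((k : ℂ) + (n + 1 : ℕ)) / Complex.Gamma ((k : ℂ) + (q + 1 : ℕ))) =
      (k + (q + 1) + n) * ((n.choose (q + 1) : ℂ) *
        (Complex.Gamma ((k : ℂ) + n) / Complex.Gamma ((k : ℂ) + (q + 1 : ℕ)))) +
      (n.choose q : ℂ) * (Complex.Gamma ((k : ℂ) + n) / Complex.Gamma ((k : ℂ) + q)) := by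
  have h0 (j : ℕ) : (k : ℂ) + j ≠ 0 := by norm_cast; omega
  have hG (j : ℕ) : Complex.Gamma ((k : ℂ) + (j + 1 : ℕ)) = (k + j) * Complex.Gamma (k + j) := by
    rw [← Complex.Gamma_add_one _ (h0 j)]; push_cast; ring_nf
  have hq : Complex.Gamma ((k : ℂ) + q) ≠ 0 :=
    Complex.Gamma_ne_zero_of_re_pos (by simp; positivity)
  have hc : ((n.choose (q + 1) : ℕ) : ℂ) * (q + 1) = n.choose q * (n - q) := by
    have := Nat.choose_succ_right_eq n q
    rcases le_or_gt q n with h | h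
    · rw [← Nat.cast_sub h]; exact_mod_cast this
    · rw [Nat.choose_eq_zero_of_lt h, Nat.choose_eq_zero_of_lt (by omega)]; simp
  have h1 := h0 q
  rw [hG, hG, Nat.choose_succ_succ]
  push_cast
  field_simp
  linear_combination (-Complex.Gamma (k + n)) * hc

lemma hasDerivAt_mgfDerivClosedForm {k : ℕ} (hk : 0 < k) (A B : ℂ) (n : ℕ) {t : ℂ}
    (ht : 1 - A * t ≠ 0) :
    HasDerivAt (mgfDerivClosedForm k A B n) (mgfDerivClosedForm k A B (n + 1) t) t := by
  set u := (1 - A * t)⁻¹ with hu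
  have hlin : HasDerivAt (fun t => 1 - A * t) (-A) t := by
    simpa using ((hasDerivAt_id t).const_mul A).const_sub 1
  have hinv : HasDerivAt (fun t => (1 - A * t)⁻¹) (A * u ^ 2) t := by
    convert! hlin.inv ht using 1
    rw [hu, inv_pow]; field_simp
  have hexp : HasDerivAt (fun t => Complex.exp (B * t * (1 - A * t)⁻¹))
      (Complex.exp (B * t * u) * (B * u ^ 2)) t := by
    have := (((hasDerivAt_id t).const_mul B).mul hinv).cexp
    convert! this using 1
    simp only [Pi.mul_apply, id, hu]
    field_simp
    ring
  have hsum : HasDerivAt (fun t => ∑ q ∈ Finset.range (n + 1),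
      (n.choose q : ℂ) * (Complex.Gamma ((k : ℂ) + n) / Complex.Gamma ((k : ℂ) + q)) *
      A ^ (n - q) * B ^ q * ((1 - A * t)⁻¹) ^ (k + q + n))
      (∑ q ∈ Finset.range (n + 1),
      (n.choose q : ℂ) * (Complex.Gamma ((k : ℂ) + n) / Complex.Gamma ((k : ℂ) + q)) *
      A ^ (n - q) * B ^ q * ((k + q + n) * u ^ (k + q + n + 1) * A)) t := by
    refine HasDerivAt.fun_sum fun q _ => HasDerivAt.const_mul _ ?_
    convert! hinv.pow (k + q + n) using 1
    obtain ⟨j, hj⟩ : ∃ j, k + q + n = j + 1 := ⟨k + q + n - 1, by omega⟩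
    have : (k + q + n : ℂ) = (j + 1 : ℕ) := by exact_mod_cast hj
    rw [this, hj]
    simp only [Nat.add_sub_cancel, ← hu]
    ring
  convert! hexp.mul hsum using 1
  rw [mgfDerivClosedForm, ← hu, mul_assoc (Complex.exp _), ← mul_add]
  congr 1
  rw [Finset.sum_range_succ', Finset.mul_sum]
  -- The index is shifted so that powers of `B` match those from the exponential; the added top term
  -- is zero since `n.choose (n + 1) = 0`.
  have e1 : ∑ q ∈ Finset.range (n + 1),
      (n.choose q : ℂ) * (Complex.Gamma ((k : ℂ) + n) / Complex.Gamma ((k : ℂ) + q)) *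
      A ^ (n - q) * B ^ q * ((k + q + n) * u ^ (k + q + n + 1) * A) =
      ∑ q ∈ Finset.range (n + 1),
      (n.choose (q + 1) : ℂ) *
        (Complex.Gamma ((k : ℂ) + n) / Complex.Gamma ((k : ℂ) + (q + 1 : ℕ))) *
      A ^ (n - (q + 1)) * B ^ (q + 1) *
        ((k + (q + 1) + n) * u ^ (k + (q + 1) + n + 1) * A) +
      (Complex.Gamma ((k : ℂ) + n) / Complex.Gamma (k : ℂ)) *
        A ^ n * ((k + n) * u ^ (k + n + 1) * A) := by
    rw [Finset.sum_range_succ', Finset.sum_range_succ _ n]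
    simp
  rw [e1]
  refine Eq.trans ?_ (add_assoc _ _ _)
  rw [← Finset.sum_add_distrib]
  congr 1
  · refine Finset.sum_congr rfl fun q hq => ?_
    have hq' : q ≤ n := by simpa [Nat.lt_succ_iff] using hq
    rw [choose_mul_Gamma_div_Gamma_recursion hk, Nat.add_sub_add_right]
    -- At `q = n` the subtraction `n - (q + 1)` is truncated, but its binomial coefficient vanishes.
    rcases hq'.eq_or_lt with rfl | hlt
    · simp only [Nat.choose_succ_self, Nat.sub_self]
      push_cast
      ring
    · obtain ⟨d, rfl⟩ := Nat.exists_eq_add_of_lt hlt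
      rw [show q + d + 1 - q = d + 1 by omega, show q + d + 1 - (q + 1) = d by omega]
      ring
  · have : Complex.Gamma ((k : ℂ) + (n + 1 : ℕ)) = (k + n) * Complex.Gamma (k + n) := by
      rw [← Complex.Gamma_add_one _ (by norm_cast; omega)]; push_cast; ring_nf
    rw [this]
    simp
    ring

section Derivatives

variable {Ω : Type*} [MeasurableSpace Ω] {P : Measure Ω} {X : Ω → ℝ}

/-- Induction by uniqueness of derivatives: the half-plane is open, so the identity for `n` holds
near `t` and may be differentiated there. -/
lemma integral_pow_mul_cexp_eq_mgfDerivClosedForm {k : ℕ} (hk : 0 < k) {A : ℝ} {B : ℂ}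
    (hA : 0 < A) (hX : Set.Iio (1 / A) ⊆ integrableExpSet X P)
    (h : ∀ t : ℂ, t.re < 1 / A → ∫ ω, Complex.exp (t * X ω) ∂P = mgfDerivClosedForm k A B 0 t)
    (n : ℕ) {t : ℂ} (ht : t.re < 1 / A) :
    ∫ ω, (X ω : ℂ) ^ n * Complex.exp (t * X ω) ∂P = mgfDerivClosedForm k A B n t := by
  have hint : ∀ t : ℂ, t.re < 1 / A → t.re ∈ interior (integrableExpSet X P) := fun t ht =>
    interior_maximal hX isOpen_Iio ht
  induction n generalizing t with
  | zero => simpa using h t ht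
  | succ n ih =>
    refine (hasDerivAt_integral_pow_mul_exp (hint t ht) n).unique ?_
    have hne : 1 - (A : ℂ) * t ≠ 0 := fun h0 => by
      have h1 := congrArg Complex.re h0
      simp only [Complex.sub_re, Complex.one_re, Complex.re_ofReal_mul, Complex.zero_re] at h1
      rw [lt_div_iff₀ hA] at ht
      linarith
    refine (hasDerivAt_mgfDerivClosedForm hk A B n hne).congr_of_eventuallyEq ?_
    filter_upwards [(isOpen_Iio.preimage Complex.continuous_re).mem_nhds ht] with s hs
    exact ih hs

end Derivatives

/-! ### Fourier coefficients under a uniform phase and Bessel functions. -/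

/-- The uniform distribution on `[0, 2π)`. -/
noncomputable abbrev uniformPhase : Measure ℝ := cond volume (Set.Ico 0 (2 * Real.pi))

instance isProbabilityMeasure_uniformPhase : IsProbabilityMeasure uniformPhase :=
  cond_isProbabilityMeasure_of_finite (by simp [Real.pi_pos])
    (by rw [Real.volume_Ico]; exact ENNReal.ofReal_ne_top)

lemma integral_uniformPhase (f : ℝ → ℂ) :
    ∫ a, f a ∂uniformPhase = (2 * Real.pi : ℂ)⁻¹ * ∫ a in (0 : ℝ)..2 * Real.pi, f a := by
  rw [intervalIntegral.integral_of_le (by positivity), ← integral_Ico_eq_integral_Ioc]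
  simp only [uniformPhase, ProbabilityTheory.cond, integral_smul_measure, Real.volume_Ico, sub_zero,
    ENNReal.toReal_inv]
  rw [ENNReal.toReal_ofReal (by positivity), Complex.real_smul]
  push_cast
  rfl

lemma integral_sub_uniformPhase {f : ℝ → ℂ} (hf : Function.Periodic f (2 * Real.pi)) (b : ℝ) :
    ∫ a, f (a - b) ∂uniformPhase = ∫ a, f a ∂uniformPhase := by
  rw [integral_uniformPhase, integral_uniformPhase,
    intervalIntegral.integral_comp_sub_right (fun x => f x) b]
  have := hf.intervalIntegral_add_eq (0 - b) 0
  rw [zero_add] at this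
  rw [← this]
  ring_nf

lemma integral_cexp_int_mul_uniformPhase (k : ℤ) :
    ∫ a : ℝ, Complex.exp (Complex.I * k * a) ∂uniformPhase = if k = 0 then 1 else 0 := by
  rw [integral_uniformPhase]
  split_ifs with hk
  · subst hk
    have : (Real.pi : ℂ) ≠ 0 := by simp [Real.pi_ne_zero]
    simp
    field_simp
  · rw [integral_exp_mul_complex (by simp [hk])]
    have : Complex.exp (Complex.I * k * (2 * Real.pi : ℝ)) = 1 := by
      rw [Complex.exp_eq_one_iff]
      exact ⟨k, by push_cast; ring⟩
    rw [this]
    simp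

lemma integrable_uniformPhase_of_norm_le {f : ℝ → ℂ} (hf : Continuous f) {C : ℝ}
    (hC : ∀ a, ‖f a‖ ≤ C) : Integrable f uniformPhase :=
  Integrable.of_bound hf.aestronglyMeasurable C (ae_of_all _ hC)

lemma hasSum_integral_uniformPhase {F : ℕ → ℝ → ℂ} {g : ℝ → ℂ} {C : ℕ → ℝ}
    (hF : ∀ j, Continuous (F j)) (hC : ∀ j a, ‖F j a‖ ≤ C j) (hs : Summable C)
    (hg : ∀ a, HasSum (F · a) (g a)) :
    HasSum (fun j => ∫ a, F j a ∂uniformPhase) (∫ a, g a ∂uniformPhase) := by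
  have hint := fun j => integrable_uniformPhase_of_norm_le (hF j) (hC j)
  simp_rw [← fun a => (hg a).tsum_eq]
  refine hasSum_integral_of_summable_integral_norm hint ?_
  refine Summable.of_nonneg_of_le (fun j => integral_nonneg fun a => norm_nonneg _) (fun j => ?_) hs
  refine (integral_mono (hint j).norm (integrable_const (C j)) (hC j)).trans ?_
  simp

lemma norm_cexp_I_mul_int_mul (k : ℤ) (a : ℝ) : ‖Complex.exp (Complex.I * k * a)‖ = 1 := by
  rw [Complex.norm_exp]; simp

lemma hasSum_cexp (x : ℂ) : HasSum (fun j : ℕ => x ^ j / (j.factorial : ℂ)) (Complex.exp x) := by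
  rw [Complex.exp_eq_exp_ℂ]
  exact NormedSpace.expSeries_div_hasSum_exp x

/-- Orthogonality of characters leaves only the term `j = k` of the exponential series, and none if
`k < 0`. -/
lemma integral_cexp_int_mul_mul_cexp_exp_neg (k : ℤ) (w : ℂ) :
    ∫ a : ℝ, Complex.exp (Complex.I * k * a) *
        Complex.exp (w * Complex.exp (Complex.I * (-1 : ℤ) * a)) ∂uniformPhase =
      if 0 ≤ k then w ^ k.toNat / (k.toNat.factorial : ℂ) else 0 := by
  have h := hasSum_integral_uniformPhase
    (F := fun j a => Complex.exp (Complex.I * k * a) *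
      ((w * Complex.exp (Complex.I * (-1 : ℤ) * a)) ^ j / (j.factorial : ℂ)))
    (C := fun j => ‖w‖ ^ j / j.factorial) (fun j => by fun_prop)
    (fun j a => by
      rw [norm_mul, norm_div, norm_pow, norm_mul, norm_cexp_I_mul_int_mul,
        norm_cexp_I_mul_int_mul]
      simp) (Real.summable_pow_div_factorial _) (fun a => (hasSum_cexp _).mul_left _)
  have hterm (j : ℕ) : ∫ a : ℝ, Complex.exp (Complex.I * k * a) *
      ((w * Complex.exp (Complex.I * (-1 : ℤ) * a)) ^ j / (j.factorial : ℂ)) ∂uniformPhase =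
      if (j : ℤ) = k then w ^ j / (j.factorial : ℂ) else 0 := by
    have : ∀ a : ℝ, Complex.exp (Complex.I * k * a) *
      ((w * Complex.exp (Complex.I * (-1 : ℤ) * a)) ^ j / (j.factorial : ℂ)) =
      w ^ j / (j.factorial : ℂ) * Complex.exp (Complex.I * (k - j : ℤ) * a) := fun a => by
      rw [mul_pow, ← Complex.exp_nat_mul,
        show Complex.I * ((k - j : ℤ) : ℂ) * a =
          Complex.I * k * a + j * (Complex.I * (-1 : ℤ) * a) by push_cast; ring, Complex.exp_add]
      ring
    simp_rw [this]
    rw [integral_const_mul, integral_cexp_int_mul_uniformPhase]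
    simp [sub_eq_zero, eq_comm]
  simp_rw [hterm] at h
  refine h.unique ?_
  split_ifs with hk
  · convert hasSum_single (f := fun j : ℕ => if (j : ℤ) = k then w ^ j / (j.factorial : ℂ) else 0)
      k.toNat fun j hj => if_neg fun h => hj (by omega) using 1
    rw [if_pos (Int.toNat_of_nonneg hk)]
  · have : ∀ j : ℕ, ¬ (j : ℤ) = k := fun j hj => hk (hj ▸ Int.natCast_nonneg j)
    simp [this, hasSum_zero]

/-- Split `exp (z cos a)` into factors in `e^{-ia}` and `e^{ia}` and expand only the latter. The
`p`-th term integrates to a coefficient of the former at frequency `k + p`, which is the `p`-th term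
of the Bessel series. -/
lemma integral_cexp_int_mul_mul_cexp_mul_cos (k : ℤ) (z : ℂ) :
    ∫ a : ℝ, Complex.exp (Complex.I * k * a) * Complex.exp (z * Real.cos a) ∂uniformPhase =
      MTW.besselI k z := by
  have hcos (a : ℝ) : Complex.exp (z * Real.cos a) =
      Complex.exp (z / 2 * Complex.exp (Complex.I * (-1 : ℤ) * a)) *
        Complex.exp (z / 2 * Complex.exp (Complex.I * (1 : ℤ) * a)) := by
    rw [← Complex.exp_add, Complex.ofReal_cos, Complex.cos]
    push_cast
    ring_nf
  have hb (m : ℤ) (a : ℝ) : ‖Complex.exp (z / 2 * Complex.exp (Complex.I * m * a))‖ ≤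
      Real.exp ‖z / 2‖ := by
    refine (Complex.norm_exp_le_exp_norm _).trans ?_
    rw [norm_mul, norm_cexp_I_mul_int_mul, mul_one]
  have h := hasSum_integral_uniformPhase
    (F := fun j a => Complex.exp (Complex.I * k * a) *
        Complex.exp (z / 2 * Complex.exp (Complex.I * (-1 : ℤ) * a)) *
      ((z / 2 * Complex.exp (Complex.I * (1 : ℤ) * a)) ^ j / (j.factorial : ℂ)))
    (C := fun j => Real.exp ‖z / 2‖ * (‖z / 2‖ ^ j / j.factorial)) (fun j => by fun_prop)
    (fun j a => by
      rw [norm_mul, norm_mul, norm_div, norm_pow, norm_mul _ (Complex.exp (_ * (1 : ℤ) * _)),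
        norm_cexp_I_mul_int_mul, norm_cexp_I_mul_int_mul, one_mul, mul_one, Complex.norm_natCast]
      gcongr
      exact hb _ _) ((Real.summable_pow_div_factorial _).mul_left _)
    (fun a => (hasSum_cexp _).mul_left _)
  simp_rw [hcos, ← mul_assoc]
  rw [← h.tsum_eq, MTW.besselI]
  congr with p
  have : ∀ a : ℝ, Complex.exp (Complex.I * k * a) *
        Complex.exp (z / 2 * Complex.exp (Complex.I * (-1 : ℤ) * a)) *
      ((z / 2 * Complex.exp (Complex.I * (1 : ℤ) * a)) ^ p / (p.factorial : ℂ)) =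
      (z / 2) ^ p / (p.factorial : ℂ) * (Complex.exp (Complex.I * (k + p : ℤ) * a) *
        Complex.exp (z / 2 * Complex.exp (Complex.I * (-1 : ℤ) * a))) := fun a => by
    rw [mul_pow, ← Complex.exp_nat_mul,
      show Complex.I * ((k + p : ℤ) : ℂ) * a =
          Complex.I * k * a + p * (Complex.I * (1 : ℤ) * a) by push_cast; ring, Complex.exp_add]
    ring
  simp_rw [this]
  rw [integral_const_mul, integral_cexp_int_mul_mul_cexp_exp_neg]
  split_ifs with hk
  · obtain ⟨q, hq⟩ := Int.eq_ofNat_of_zero_le hk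
    have hq' : (k : ℂ) + p = q := by exact_mod_cast hq
    rw [hq, hq', Complex.Gamma_nat_eq_factorial, show 2 * (p : ℤ) + k = ((p + q : ℕ) : ℤ) by
      push_cast; linarith, zpow_natCast, pow_add, Int.toNat_natCast]
    field_simp
  -- For `k + p < 0` the Gamma argument is a pole, where the default value `0` makes the series term
  -- vanish, like the integral.
  · have hq : ∃ q : ℕ, k + p + 1 = -(q : ℤ) := ⟨(-(k + p + 1)).toNat, by omega⟩
    obtain ⟨q, hq⟩ := hq
    have hq' : (k : ℂ) + p + 1 = -q := by exact_mod_cast hq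
    rw [hq', Complex.Gamma_neg_nat_eq_zero]
    simp

lemma two_mul_cos_pow (a : ℝ) (r : ℕ) :
    (2 * Real.cos a : ℂ) ^ r =
      ∑ l ∈ Finset.range (r + 1),
        (r.choose l : ℂ) * Complex.exp (Complex.I * (2 * l - r : ℤ) * a) := by
  have : (2 * Real.cos a : ℂ) = Complex.exp (Complex.I * a) + Complex.exp (-(Complex.I * a)) := by
    rw [Complex.ofReal_cos, Complex.cos]; ring_nf
  rw [this, add_pow]
  refine Finset.sum_congr rfl fun l hl => ?_
  have hl' : l ≤ r := by simpa [Nat.lt_succ_iff] using hl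
  rw [← Complex.exp_nat_mul, ← Complex.exp_nat_mul, ← Complex.exp_add, mul_comm]
  congr 2
  rw [Nat.cast_sub hl']
  push_cast
  ring

lemma norm_cexp_mul_cos_le (z : ℂ) (a : ℝ) : ‖Complex.exp (z * Real.cos a)‖ ≤ Real.exp ‖z‖ := by
  refine (Complex.norm_exp_le_exp_norm _).trans ?_
  rw [norm_mul]
  gcongr
  refine mul_le_of_le_one_right (norm_nonneg _) ?_
  rw [Complex.norm_real]; exact Real.abs_cos_le_one a

/-- Expanding `(2 cos a) ^ r` in characters gives frequencies `2l - r`, hence the Bessel orders. -/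
lemma integral_mul_cos_pow_mul_cexp (D z : ℂ) (r : ℕ) :
    ∫ a : ℝ, (D * Real.cos a) ^ r * Complex.exp (z * Real.cos a) ∂uniformPhase =
      (D / 2) ^ r * ∑ l ∈ Finset.range (r + 1),
        (r.choose l : ℂ) * MTW.besselI (2 * l - r) z := by
  have : ∀ a : ℝ, (D * Real.cos a) ^ r * Complex.exp (z * Real.cos a) =
      (D / 2) ^ r * ∑ l ∈ Finset.range (r + 1), (r.choose l : ℂ) *
        (Complex.exp (Complex.I * (2 * l - r : ℤ) * a) * Complex.exp (z * Real.cos a)) := by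
    intro a
    rw [show D * Real.cos a = D / 2 * (2 * Real.cos a) by ring, mul_pow, two_mul_cos_pow, mul_assoc,
      Finset.sum_mul]
    simp_rw [mul_assoc]
  simp_rw [this]
  rw [integral_const_mul, integral_finsetSum]
  · simp_rw [integral_const_mul, integral_cexp_int_mul_mul_cexp_mul_cos]
  · intro l _
    refine (integrable_uniformPhase_of_norm_le (C := Real.exp ‖z‖) (by fun_prop)
      fun a => ?_).const_mul _
    rw [norm_mul, norm_cexp_I_mul_int_mul, one_mul]
    exact norm_cexp_mul_cos_le z a

/-! ### Averages over phase differences. -/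

section PhasePairs

variable {ι κ : Type*} [Fintype ι] [Fintype κ]

/-- The law of the phases of two independent families of waves indexed by `ι`. -/
noncomputable abbrev phasePairs (ι : Type*) [Fintype ι] : Measure ((ι → ℝ) × (ι → ℝ)) :=
  (Measure.pi fun _ => uniformPhase).prod (Measure.pi fun _ => uniformPhase)

lemma integrable_phasePairs_of_norm_le {f : (ι → ℝ) × (ι → ℝ) → ℂ} (hf : Continuous f) {C : ℝ}
    (hC : ∀ p, ‖f p‖ ≤ C) : Integrable f (phasePairs ι) :=
  Integrable.of_bound hf.aestronglyMeasurable C (ae_of_all _ hC)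

/-- With the second family of phases frozen, the first family is still independent, and periodicity
absorbs each shift; the inner integral is thus constant. -/
lemma integral_prod_comp_sub_phasePairs {e : κ → ι} (he : Function.Injective e)
    {f : κ → ℝ → ℂ} (hf : ∀ j, Continuous (f j)) (hper : ∀ j, Function.Periodic (f j) (2 * Real.pi))
    {C : κ → ℝ} (hC : ∀ j a, ‖f j a‖ ≤ C j) :
    ∫ p, ∏ j, f j (p.1 (e j) - p.2 (e j)) ∂(phasePairs ι) =
      ∏ j, ∫ a, f j a ∂uniformPhase := by
  have hint : Integrable (fun p : (ι → ℝ) × (ι → ℝ) => ∏ j, f j (p.1 (e j) - p.2 (e j)))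
      (phasePairs ι) := by
    refine integrable_phasePairs_of_norm_le (C := ∏ j, C j) (by fun_prop) fun p => ?_
    rw [norm_prod]
    exact Finset.prod_le_prod (fun _ _ => norm_nonneg _) fun j _ => hC j _
  rw [integral_prod_symm _ hint]
  have hind : iIndepFun (fun (j : κ) (x : ι → ℝ) => x (e j))
      (Measure.pi fun _ : ι => uniformPhase) :=
    (iIndepFun_pi (μ := fun _ : ι => uniformPhase) (X := fun _ => id)
      fun _ => aemeasurable_id).precomp he
  have key (y : ι → ℝ) : ∫ x : ι → ℝ, ∏ j, f j (x (e j) - y (e j))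
      ∂(Measure.pi fun _ => uniformPhase) = ∏ j, ∫ a, f j a ∂uniformPhase := by
    rw [hind.integral_fun_prod_comp (f := fun j a => f j (a - y (e j)))
      (fun j => (measurable_pi_apply (e j)).aemeasurable)
      (fun j => (by fun_prop : Continuous _).aestronglyMeasurable)]
    refine Finset.prod_congr rfl fun j _ => ?_
    rw [← integral_sub_uniformPhase (hper j) (y (e j))]
    exact (measurePreserving_eval (fun _ : ι => uniformPhase) (e j)).hasLaw.integral_comp
      (f := fun a => f j (a - y (e j))) (by fun_prop : Continuous _).aestronglyMeasurable
  simp_rw [key]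
  simp

lemma norm_mul_cos_pow_mul_cexp_le (D z : ℂ) (r : ℕ) (a : ℝ) :
    ‖(D * Real.cos a) ^ r * Complex.exp (z * Real.cos a)‖ ≤ ‖D‖ ^ r * Real.exp ‖z‖ := by
  rw [norm_mul, norm_pow, norm_mul]
  gcongr
  · refine mul_le_of_le_one_right (norm_nonneg _) ?_
    rw [Complex.norm_real]; exact Real.abs_cos_le_one a
  · exact norm_cexp_mul_cos_le z a

lemma multinomial_eq_factorial_mul_prod [DecidableEq κ] {r : ℕ} {t : κ → ℕ}
    (ht : t ∈ Finset.piAntidiag Finset.univ r) :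
    (Nat.multinomial Finset.univ t : ℂ) =
      (r.factorial : ℂ) * ∏ j, (1 / ((t j).factorial : ℂ)) := by
  rw [Finset.mem_piAntidiag] at ht
  have := Nat.multinomial_spec Finset.univ t
  rw [ht.1] at this
  rw [← this]
  push_cast
  have h : (∏ j, ((t j).factorial : ℂ)) ≠ 0 :=
    Finset.prod_ne_zero_iff.2 fun j _ => by exact_mod_cast (t j).factorial_ne_zero
  simp only [one_div, Finset.prod_inv_distrib]
  field_simp

/-- The binomial and multinomial theorems turn the power into products with one factor per cluster,
which independence can integrate. -/
lemma one_add_sum_pow_mul_prod [DecidableEq κ] (x y : κ → ℂ) (q : ℕ) :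
    (1 + ∑ j, x j) ^ q * ∏ j, y j =
      ∑ r ∈ Finset.range (q + 1), (q.choose r : ℂ) * (r.factorial : ℂ) *
        ∑ t ∈ Finset.piAntidiag Finset.univ r,
          (∏ j, (1 / ((t j).factorial : ℂ))) * ∏ j, x j ^ t j * y j := by
  rw [add_comm, add_pow, Finset.sum_mul]
  refine Finset.sum_congr rfl fun r _ => ?_
  rw [Finset.sum_pow_eq_sum_piAntidiag, one_pow, mul_one, Finset.mul_sum, Finset.sum_mul,
    Finset.sum_mul]
  refine Finset.sum_congr rfl fun t ht => ?_
  rw [multinomial_eq_factorial_mul_prod ht, Finset.prod_mul_distrib]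
  ring

lemma integral_one_add_sum_pow_mul_prod_cexp [DecidableEq κ] {e : κ → ι}
    (he : Function.Injective e) (D z : κ → ℂ) (q : ℕ) :
    ∫ p, (1 + ∑ j, D j * Real.cos (p.1 (e j) - p.2 (e j))) ^ q *
        ∏ j, Complex.exp (z j * Real.cos (p.1 (e j) - p.2 (e j))) ∂(phasePairs ι) =
      ∑ r ∈ Finset.range (q + 1), (q.choose r : ℂ) * (r.factorial : ℂ) *
        ∑ t ∈ Finset.piAntidiag Finset.univ r,
          ∏ j, (1 / ((t j).factorial : ℂ) * (D j / 2) ^ t j *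
            ∑ l ∈ Finset.range (t j + 1), ((t j).choose l : ℂ) *
              MTW.besselI (2 * l - t j) (z j)) := by
  simp_rw [one_add_sum_pow_mul_prod]
  have hint (t : κ → ℕ) : Integrable (fun p : (ι → ℝ) × (ι → ℝ) => ∏ j,
      (D j * Real.cos (p.1 (e j) - p.2 (e j))) ^ t j *
        Complex.exp (z j * Real.cos (p.1 (e j) - p.2 (e j)))) (phasePairs ι) := by
    refine integrable_phasePairs_of_norm_le (C := ∏ j, ‖D j‖ ^ t j * Real.exp ‖z j‖)
      (by fun_prop) fun p => ?_
    rw [norm_prod]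
    exact Finset.prod_le_prod (fun _ _ => norm_nonneg _)
      fun j _ => norm_mul_cos_pow_mul_cexp_le _ _ _ _
  rw [integral_finsetSum _ fun r _ => (integrable_finsetSum _ fun t _ =>
    (hint t).const_mul _).const_mul _]
  refine Finset.sum_congr rfl fun r _ => ?_
  rw [integral_const_mul, integral_finsetSum _ fun t _ => (hint t).const_mul _]
  congr 1
  refine Finset.sum_congr rfl fun t _ => ?_
  rw [integral_const_mul, integral_prod_comp_sub_phasePairs he
    (f := fun j a => (D j * Real.cos a) ^ t j * Complex.exp (z j * Real.cos a))
    (fun j => by fun_prop) (fun j a => by simp only [Real.cos_add_two_pi])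
    (fun j a => norm_mul_cos_pow_mul_cexp_le _ _ _ _), ← Finset.prod_mul_distrib]
  refine Finset.prod_congr rfl fun j _ => ?_
  rw [integral_mul_cos_pow_mul_cexp, mul_assoc]

end PhasePairs

/-! ### Specular amplitude of one cluster. -/

section SpecularAmplitude

variable {ι : Type*}

/-- The specular part of the amplitude of cluster `i`. -/
noncomputable def specularAmplitude (V : ι → Fin 2 → ℝ) (p : (ι → ℝ) × (ι → ℝ)) (i : ι) : ℂ :=
  V i 0 * Complex.exp (Complex.I * p.1 i) + V i 1 * Complex.exp (Complex.I * p.2 i)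

lemma sq_norm_specularAmplitude (V : ι → Fin 2 → ℝ) (p : (ι → ℝ) × (ι → ℝ)) (i : ι) :
    ‖specularAmplitude V p i‖ ^ 2 =
      V i 0 ^ 2 + V i 1 ^ 2 + 2 * V i 0 * V i 1 * Real.cos (p.1 i - p.2 i) := by
  rw [specularAmplitude, mul_comm Complex.I, mul_comm Complex.I, Complex.sq_norm,
    Complex.normSq_apply, Real.cos_sub]
  simp only [Complex.add_re, Complex.add_im, Complex.re_ofReal_mul, Complex.im_ofReal_mul,
    Complex.exp_ofReal_mul_I_re, Complex.exp_ofReal_mul_I_im]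
  linear_combination (V i 0 ^ 2) * Real.sin_sq_add_cos_sq (p.1 i) +
    (V i 1 ^ 2) * Real.sin_sq_add_cos_sq (p.2 i)

end SpecularAmplitude

/-! ### Moments of the received power. -/

section ReceivedPower

variable {ι κ : Type*} [Fintype ι] [Fintype κ] {v : NNReal}

/-- The law of the phases and of the diffuse components of all clusters. -/
noncomputable abbrev channelLaw (ι : Type*) [Fintype ι] (v : NNReal) :
    Measure (((ι → ℝ) × (ι → ℝ)) × ((ι → ℝ) × (ι → ℝ))) :=
  (phasePairs ι).prod
    ((Measure.pi fun _ => gaussianReal 0 v).prod (Measure.pi fun _ => gaussianReal 0 v))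

/-- The power received in the specular waves if there is no diffuse part. -/
noncomputable def specularPower (V : ι → Fin 2 → ℝ) (p : (ι → ℝ) × (ι → ℝ)) : ℝ :=
  ∑ i, ‖specularAmplitude V p i‖ ^ 2

/-- The total received power, as a function of the phases and the diffuse components. -/
noncomputable def totalPower (V : ι → Fin 2 → ℝ)
    (w : ((ι → ℝ) × (ι → ℝ)) × ((ι → ℝ) × (ι → ℝ))) : ℝ :=
  ∑ i, ‖specularAmplitude V w.1 i + (w.2.1 i + Complex.I * w.2.2 i)‖ ^ 2

lemma continuous_specularPower (V : ι → Fin 2 → ℝ) : Continuous (specularPower V) := by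
  unfold specularPower specularAmplitude; fun_prop

lemma continuous_totalPower (V : ι → Fin 2 → ℝ) : Continuous (totalPower V) := by
  unfold totalPower specularAmplitude; fun_prop

lemma specularPower_eq (V : ι → Fin 2 → ℝ) (p : (ι → ℝ) × (ι → ℝ)) :
    specularPower V p = ∑ i, (V i 0 ^ 2 + V i 1 ^ 2) +
      ∑ i, 2 * V i 0 * V i 1 * Real.cos (p.1 i - p.2 i) := by
  simp_rw [specularPower, sq_norm_specularAmplitude, Finset.sum_add_distrib]

lemma abs_specularPower_le (V : ι → Fin 2 → ℝ) (p : (ι → ℝ) × (ι → ℝ)) :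
    |specularPower V p| ≤
      ∑ i, (V i 0 ^ 2 + V i 1 ^ 2) + ∑ i, |2 * V i 0 * V i 1| := by
  rw [specularPower_eq]
  refine (abs_add_le _ _).trans (add_le_add ?_ ?_)
  · rw [abs_of_nonneg (by positivity)]
  · refine (Finset.abs_sum_le_sum_abs _ _).trans (Finset.sum_le_sum fun i _ => ?_)
    rw [abs_mul]
    exact mul_le_of_le_one_right (abs_nonneg _) (Real.abs_cos_le_one _)

lemma integrable_cexp_mul_totalPower_mk (hv : v ≠ 0) {z : ℂ} (hz : z.re < 1 / (2 * v))
    (V : ι → Fin 2 → ℝ) (p : (ι → ℝ) × (ι → ℝ)) :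
    Integrable (fun g => Complex.exp (z * totalPower V (p, g)))
      ((Measure.pi fun _ => gaussianReal 0 v).prod (Measure.pi fun _ => gaussianReal 0 v)) := by
  simpa only [totalPower] using integrable_cexp_mul_sum_sq_norm hv hz (specularAmplitude V p)

lemma integral_cexp_mul_totalPower_mk (hv : v ≠ 0) {z : ℂ} (hz : z.re < 1 / (2 * v))
    (V : ι → Fin 2 → ℝ) (p : (ι → ℝ) × (ι → ℝ)) :
    ∫ g, Complex.exp (z * totalPower V (p, g))
        ∂((Measure.pi fun _ => gaussianReal 0 v).prod (Measure.pi fun _ => gaussianReal 0 v)) =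
      ((1 - 2 * v * z)⁻¹) ^ Fintype.card ι *
        Complex.exp (specularPower V p * z * (1 - 2 * v * z)⁻¹) := by
  simpa only [totalPower, specularPower] using
    integral_cexp_mul_sum_sq_norm hv hz (specularAmplitude V p)

lemma integrable_cexp_mul_totalPower (hv : v ≠ 0) {z : ℂ} (hz : z.re < 1 / (2 * v))
    (V : ι → Fin 2 → ℝ) :
    Integrable (fun w => Complex.exp (z * totalPower V w)) (channelLaw ι v) := by
  have hcont : Continuous fun w => Complex.exp (z * totalPower V w) := by
    have := continuous_totalPower V
    fun_prop
  refine (integrable_prod_iff hcont.aestronglyMeasurable).2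
    ⟨ae_of_all _ fun p => integrable_cexp_mul_totalPower_mk hv hz V p, ?_⟩
  -- The norm of the integrand is the same exponential at `z.re`, so its conditional integral has
  -- the closed form, bounded in the phases.
  have hre : (z.re : ℂ).re < 1 / (2 * v) := by simpa using hz
  set u : ℂ := (1 - 2 * (v : ℂ) * (z.re : ℂ))⁻¹
  have hnorm (p : (ι → ℝ) × (ι → ℝ)) :
      ∫ g, ‖Complex.exp (z * totalPower V (p, g))‖
        ∂((Measure.pi fun _ => gaussianReal 0 v).prod (Measure.pi fun _ => gaussianReal 0 v)) =
      ‖u ^ Fintype.card ι * Complex.exp (specularPower V p * z.re * u)‖ := by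
    have h := integral_cexp_mul_totalPower_mk hv hre V p
    have h2 (g : (ι → ℝ) × (ι → ℝ)) : Complex.exp (z.re * totalPower V (p, g)) =
        ((‖Complex.exp (z * totalPower V (p, g))‖ : ℝ) : ℂ) := by
      rw [Complex.norm_exp, Complex.re_mul_ofReal]
      push_cast
      rfl
    simp_rw [h2] at h
    rw [integral_complex_ofReal] at h
    rw [← Real.norm_of_nonneg (integral_nonneg fun _ => norm_nonneg _), ← Complex.norm_real, h]
  simp_rw [hnorm]
  refine (integrable_phasePairs_of_norm_le (C := ‖u ^ Fintype.card ι‖ *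
    Real.exp ((∑ i, (V i 0 ^ 2 + V i 1 ^ 2) + ∑ i, |2 * V i 0 * V i 1|) * ‖z.re * u‖))
    ?_ fun p => ?_).norm
  · have := continuous_specularPower V
    fun_prop
  · rw [norm_mul]
    gcongr
    refine (Complex.norm_exp_le_exp_norm _).trans ?_
    rw [mul_assoc, norm_mul, Complex.norm_real]
    gcongr
    exact abs_specularPower_le V p

lemma subset_integrableExpSet_of_integrable_cexp {Ω : Type*} [MeasurableSpace Ω] {P : Measure Ω}
    {X : Ω → ℝ} {a : ℝ}
    (h : ∀ z : ℂ, z.re < a → Integrable (fun ω => Complex.exp (z * X ω)) P) :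
    Set.Iio a ⊆ integrableExpSet X P := fun t ht => by
  have := (h t (by simpa using ht)).norm
  simpa [integrableExpSet, Complex.norm_exp] using this

lemma integral_totalPower_pow_mul_cexp_eq_integral_specularPower [Nonempty ι] (hv : v ≠ 0) {t : ℂ}
    (ht : t.re < 1 / (2 * v)) (V : ι → Fin 2 → ℝ) (n : ℕ) :
    Integrable (fun w => (totalPower V w : ℂ) ^ n * Complex.exp (t * totalPower V w))
      (channelLaw ι v) ∧
    ∫ w, (totalPower V w : ℂ) ^ n * Complex.exp (t * totalPower V w) ∂(channelLaw ι v) =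
      ∫ p, mgfDerivClosedForm (Fintype.card ι) (2 * v) (specularPower V p) n t
        ∂(phasePairs ι) := by
  have hset := subset_integrableExpSet_of_integrable_cexp
    fun z hz => integrable_cexp_mul_totalPower hv hz V
  have hint := integrable_pow_mul_cexp_of_re_mem_interior_integrableExpSet
    (interior_maximal hset isOpen_Iio ht) n
  refine ⟨hint, ?_⟩
  rw [integral_prod _ hint]
  refine integral_congr_ae (ae_of_all _ fun p => ?_)
  have hA : (0 : ℝ) < 2 * v := by positivity
  have := integral_pow_mul_cexp_eq_mgfDerivClosedForm (k := Fintype.card ι) Fintype.card_pos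
    (B := specularPower V p) hA
    (P := (Measure.pi fun _ => gaussianReal 0 v).prod (Measure.pi fun _ => gaussianReal 0 v))
    (X := fun g => totalPower V (p, g))
    (subset_integrableExpSet_of_integrable_cexp
      fun z hz => integrable_cexp_mul_totalPower_mk hv hz V p)
    (fun z hz => by
      have hk : Complex.Gamma (Fintype.card ι) ≠ 0 :=
        Complex.Gamma_ne_zero_of_re_pos (by simp [Fintype.card_pos])
      rw [integral_cexp_mul_totalPower_mk hv hz V p]
      simp [mgfDerivClosedForm, hk, mul_comm]) n ht
  simpa using this

/-- The phase average of `(1 + ∑ D_j cos θ_j) ^ q * ∏ exp (z_j cos θ_j)` in terms of Bessel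
functions. -/
noncomputable def besselMoment [DecidableEq κ] (D z : κ → ℂ) (q : ℕ) : ℂ :=
  ∑ r ∈ Finset.range (q + 1), (q.choose r : ℂ) * (r.factorial : ℂ) *
    ∑ t ∈ Finset.piAntidiag Finset.univ r,
      ∏ j, (1 / ((t j).factorial : ℂ) * (D j / 2) ^ t j *
        ∑ l ∈ Finset.range (t j + 1), ((t j).choose l : ℂ) *
          MTW.besselI (2 * l - t j) (z j))

/-- Clusters outside the range of `e` have no cosine term. Stating `hD` as a product keeps the case
`S = 0` uniform. -/
lemma specularPower_eq_mul_one_add_sum {V : ι → Fin 2 → ℝ} {e : κ → ι}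
    (he : Function.Injective e) (hV0 : ∀ i ∉ Set.range e, V i 0 = 0 ∨ V i 1 = 0) {S : ℝ}
    (hS : S = ∑ i, (V i 0 ^ 2 + V i 1 ^ 2)) {D : κ → ℝ}
    (hD : ∀ j, S * D j = 2 * V (e j) 0 * V (e j) 1) (p : (ι → ℝ) × (ι → ℝ)) :
    specularPower V p = S * (1 + ∑ j, D j * Real.cos (p.1 (e j) - p.2 (e j))) := by
  rw [specularPower_eq, ← hS, mul_add, mul_one, Finset.mul_sum]
  congr 1
  refine (Fintype.sum_of_injective e he _ _ (fun i hi => ?_) fun j => ?_).symm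
  · rcases hV0 i hi with h | h <;> simp [h]
  · rw [← mul_assoc, hD]

lemma integral_totalPower_pow_mul_cexp [Nonempty ι] [DecidableEq κ] (hv : v ≠ 0) {t : ℂ}
    (ht : t.re < 1 / (2 * v)) {V : ι → Fin 2 → ℝ} {e : κ → ι}
    (he : Function.Injective e) (hV0 : ∀ i ∉ Set.range e, V i 0 = 0 ∨ V i 1 = 0) {S : ℝ}
    (hS : S = ∑ i, (V i 0 ^ 2 + V i 1 ^ 2)) {D : κ → ℝ}
    (hD : ∀ j, S * D j = 2 * V (e j) 0 * V (e j) 1) (n : ℕ) :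
    ∫ w, (totalPower V w : ℂ) ^ n * Complex.exp (t * totalPower V w) ∂(channelLaw ι v) =
      Complex.exp (S * t * (1 - 2 * v * t)⁻¹) * ∑ q ∈ Finset.range (n + 1),
        (n.choose q : ℂ) * (Complex.Gamma ((Fintype.card ι : ℂ) + n) /
          Complex.Gamma ((Fintype.card ι : ℂ) + q)) * (2 * v) ^ (n - q) * S ^ q *
          ((1 - 2 * v * t)⁻¹) ^ (Fintype.card ι + q + n) *
          besselMoment (fun j => (D j : ℂ)) (fun j => S * t * (1 - 2 * v * t)⁻¹ * D j) q := by
  rw [(integral_totalPower_pow_mul_cexp_eq_integral_specularPower hv ht V n).2]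
  set u : ℂ := (1 - 2 * (v : ℂ) * t)⁻¹ with hu
  have hcf (p : (ι → ℝ) × (ι → ℝ)) :
      mgfDerivClosedForm (Fintype.card ι) (2 * v) (specularPower V p) n t =
      ∑ q ∈ Finset.range (n + 1), (Complex.exp (S * t * u) *
        ((n.choose q : ℂ) * (Complex.Gamma ((Fintype.card ι : ℂ) + n) /
          Complex.Gamma ((Fintype.card ι : ℂ) + q)) * (2 * v) ^ (n - q) * S ^ q *
          u ^ (Fintype.card ι + q + n))) *
        ((1 + ∑ j, (D j : ℂ) * Real.cos (p.1 (e j) - p.2 (e j))) ^ q *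
        ∏ j, Complex.exp (S * t * u * D j * Real.cos (p.1 (e j) - p.2 (e j)))) := by
    have hM : (specularPower V p : ℂ) =
        S * (1 + ∑ j, (D j : ℂ) * Real.cos (p.1 (e j) - p.2 (e j))) := by
      rw [specularPower_eq_mul_one_add_sum he hV0 hS hD]; push_cast; rfl
    have hE : Complex.exp (specularPower V p * t * u) = Complex.exp (S * t * u) *
        ∏ j, Complex.exp (S * t * u * D j * Real.cos (p.1 (e j) - p.2 (e j))) := by
      rw [← Complex.exp_sum, ← Complex.exp_add, hM]
      simp_rw [mul_assoc (_ * _ * _) (D _ : ℂ)]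
      rw [← Finset.mul_sum]
      congr 1
      ring
    rw [mgfDerivClosedForm, ← hu, hE, Finset.mul_sum]
    refine Finset.sum_congr rfl fun q _ => ?_
    rw [hM, mul_pow (S : ℂ)]
    ring
  simp_rw [hcf]
  have hint (q : ℕ) : Integrable (fun p : (ι → ℝ) × (ι → ℝ) =>
      (1 + ∑ j, (D j : ℂ) * Real.cos (p.1 (e j) - p.2 (e j))) ^ q *
        ∏ j, Complex.exp (S * t * u * D j * Real.cos (p.1 (e j) - p.2 (e j)))) (phasePairs ι) := by
    refine integrable_phasePairs_of_norm_le (C := (1 + ∑ j, ‖(D j : ℂ)‖) ^ q *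
      ∏ j, Real.exp ‖S * t * u * D j‖) (by fun_prop) fun p => ?_
    rw [norm_mul, norm_pow, norm_prod]
    gcongr
    · refine (norm_add_le _ _).trans (add_le_add (by simp) ((norm_sum_le _ _).trans ?_))
      gcongr with j
      rw [norm_mul]
      refine mul_le_of_le_one_right (norm_nonneg _) ?_
      rw [Complex.norm_real]; exact Real.abs_cos_le_one _
    · exact norm_cexp_mul_cos_le _ _
  rw [integral_finsetSum _ fun q _ => (hint q).const_mul _, Finset.mul_sum]
  refine Finset.sum_congr rfl fun q _ => ?_
  rw [integral_const_mul, integral_one_add_sum_pow_mul_prod_cexp he, besselMoment, mul_assoc]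

lemma integral_cos_sub_phasePairs (i : ι) :
    ∫ p, (Real.cos (p.1 i - p.2 i) : ℂ) ∂(phasePairs ι) = 0 := by
  have h := integral_prod_comp_sub_phasePairs (κ := Unit) (e := fun _ => i)
    (fun _ _ _ => rfl) (f := fun _ a => (Real.cos a : ℂ)) (fun _ => by fun_prop)
    (fun _ a => by simp only [Real.cos_add_two_pi]) (C := fun _ => 1)
    (fun _ a => by rw [Complex.norm_real]; exact Real.abs_cos_le_one a)
  simp only [Finset.univ_unique, Finset.prod_singleton] at h
  rw [h, integral_uniformPhase, intervalIntegral.integral_ofReal]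
  simp

/-- The case `n = 1`, `t = 0`, in which the cosines average to zero. -/
lemma integral_totalPower [Nonempty ι] (hv : v ≠ 0) (V : ι → Fin 2 → ℝ) :
    ∫ w, totalPower V w ∂(channelLaw ι v) =
      2 * v * Fintype.card ι + ∑ i, (V i 0 ^ 2 + V i 1 ^ 2) := by
  have h := (integral_totalPower_pow_mul_cexp_eq_integral_specularPower hv (t := 0)
    (by simp; positivity) V 1).2
  have hG : Complex.Gamma ((Fintype.card ι : ℂ) + 1) / Complex.Gamma (Fintype.card ι) =
      Fintype.card ι := by
    rw [Complex.Gamma_add_one _ (by simp), mul_div_assoc, div_self, mul_one]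
    exact Complex.Gamma_ne_zero_of_re_pos (by simp [Fintype.card_pos])
  have hG1 : Complex.Gamma ((Fintype.card ι : ℂ) + 1) ≠ 0 :=
    Complex.Gamma_ne_zero_of_re_pos (by simp; positivity)
  have hcf (p : (ι → ℝ) × (ι → ℝ)) :
      mgfDerivClosedForm (Fintype.card ι) (2 * v) (specularPower V p) 1 0 =
      (2 * v * Fintype.card ι + ∑ i, (V i 0 ^ 2 + V i 1 ^ 2) : ℝ) +
        ∑ i, ((2 * V i 0 * V i 1 : ℝ) : ℂ) * (Real.cos (p.1 i - p.2 i) : ℂ) := by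
    simp only [mgfDerivClosedForm, Finset.sum_range_succ, Finset.sum_range_zero]
    simp [hG, hG1, specularPower_eq]
    ring
  have hint (i : ι) : Integrable (fun p : (ι → ℝ) × (ι → ℝ) =>
      ((2 * V i 0 * V i 1 : ℝ) : ℂ) * (Real.cos (p.1 i - p.2 i) : ℂ)) (phasePairs ι) :=
    (integrable_phasePairs_of_norm_le (C := 1) (by fun_prop)
      fun p => by rw [Complex.norm_real]; exact Real.abs_cos_le_one _).const_mul _
  simp_rw [hcf] at h
  rw [integral_add (integrable_const _) (integrable_finsetSum _ fun i _ => hint i),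
    integral_finsetSum _ fun i _ => hint i] at h
  simp_rw [integral_const_mul, integral_cos_sub_phasePairs] at h
  simp only [pow_one, zero_mul, Complex.exp_zero, mul_one, integral_complex_ofReal, mul_zero,
    Finset.sum_const_zero, add_zero, integral_const, probReal_univ, one_smul] at h
  exact_mod_cast h

end ReceivedPower

/-! ### From the channel to the product law, and the final substitution. -/

lemma hasLaw_channelLaw {Ω : Type*} [MeasurableSpace Ω] {P : Measure Ω} {μ : ℕ} {σ : ℝ}
    {φ : Fin μ → Fin 2 → Ω → ℝ} {X Y : Fin μ → Ω → ℝ} (h : MTW.IsMTWChannel P σ φ X Y) :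
    HasLaw (fun ω => ((fun i => φ i 0 ω, fun i => φ i 1 ω), (fun i => X i ω, fun i => Y i ω)))
      (channelLaw (Fin μ) (Real.toNNReal (σ ^ 2))) P := by
  let e : (Fin μ ⊕ Fin μ) ⊕ (Fin μ ⊕ Fin μ) → (Fin μ × Fin 2) ⊕ (Fin μ ⊕ Fin μ) :=
    Sum.map (Sum.elim (fun i => (i, 0)) fun i => (i, 1)) id
  have he : Function.Injective e := by
    refine Function.Injective.sumMap ?_ Function.injective_id
    refine Function.Injective.sumElim ?_ ?_ ?_ <;> simp [Function.Injective]
  have hind := h.indep.precomp he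
  let g : Measure ℝ := gaussianReal 0 (Real.toNNReal (σ ^ 2))
  let m₁ : Fin μ ⊕ Fin μ → Measure ℝ := Sum.elim (fun _ => uniformPhase) fun _ => uniformPhase
  let m₂ : Fin μ ⊕ Fin μ → Measure ℝ := Sum.elim (fun _ => g) fun _ => g
  have hm₁ : ∀ i, SigmaFinite (m₁ i) := by
    rintro (i | i) <;> exact inferInstanceAs (SigmaFinite uniformPhase)
  have hm₂ : ∀ i, SigmaFinite (m₂ i) := by
    rintro (i | i) <;> exact inferInstanceAs (SigmaFinite g)
  have hm : ∀ i, SigmaFinite (Sum.elim m₁ m₂ i) := by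
    rintro (i | i)
    exacts [hm₁ i, hm₂ i]
  have hlaw := hind.hasLaw_pi (μ := Sum.elim m₁ m₂) (by
    rintro ((i | i) | (i | i))
    exacts [h.phase_law i 0, h.phase_law i 1, h.inPhase_law i, h.quadrature_law i])
  exact ((measurePreserving_sumPiEquivProdPi m₁).prod
    (measurePreserving_sumPiEquivProdPi m₂)).comp_hasLaw
      ((measurePreserving_sumPiEquivProdPi (Sum.elim m₁ m₂)).comp_hasLaw hlaw)

theorem lemma3 {Ω : Type*} [MeasurableSpace Ω] (P : Measure Ω) [IsProbabilityMeasure P]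
    (μ N n : ℕ) (hμ : 0 < μ) (hN : N ≤ μ)
    (σ Es N0 : ℝ) (hσ : 0 < σ) (hEs : 0 < Es) (hN0 : 0 < N0)
    (V : Fin μ → Fin 2 → ℝ) (hV : ∀ i k, 0 ≤ V i k)
    (hV0 : ∀ i : Fin μ, N ≤ (i : ℕ) → V i 0 = 0 ∨ V i 1 = 0)
    (φ : Fin μ → Fin 2 → Ω → ℝ) (X Y : Fin μ → Ω → ℝ)
    (hchan : MTW.IsMTWChannel P σ φ X Y)
    (γ : Ω → ℝ) (hγ : γ = MTW.snr V φ X Y Es N0)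
    (γbar : ℝ) (hγbar : γbar = ∫ ω, γ ω ∂P)
    (K : ℝ) (hK : K = MTW.paramK V σ)
    (Δ : Fin N → ℝ) (hΔ : ∀ i : Fin N, Δ i = MTW.paramDelta V (Fin.castLE hN i))
    (s : ℂ) (hs : s.re < (μ : ℝ) * (1 + K) / γbar) :
    Integrable (fun ω => (γ ω : ℂ) ^ n * Complex.exp ((γ ω : ℂ) * s)) P ∧
    MTW.generalizedMGF P γ n s =
      (γbar : ℂ) ^ n * Complex.Gamma ((μ : ℂ) + (n : ℂ)) *
        Complex.exp (((μ : ℂ) * (K : ℂ) * (γbar : ℂ) * s) /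
          ((μ : ℂ) * (1 + (K : ℂ)) - (γbar : ℂ) * s)) *
        ∑ q ∈ Finset.range (n + 1),
          (n.choose q : ℂ) * (((μ : ℂ) * (K : ℂ)) ^ q / Complex.Gamma ((μ : ℂ) + (q : ℂ))) *
            (((μ : ℂ) * (1 + (K : ℂ))) ^ (μ + q) /
              ((μ : ℂ) * (1 + (K : ℂ)) - (γbar : ℂ) * s) ^ (μ + q + n)) *
            ∑ r ∈ Finset.range (q + 1),
              (q.choose r : ℂ) * (Nat.factorial r : ℂ) *
                ∑ t ∈ Finset.piAntidiag (Finset.univ : Finset (Fin N)) r,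
                  ∏ i : Fin N,
                    (1 / (Nat.factorial (t i) : ℂ) * ((Δ i : ℂ) / 2) ^ (t i) *
                      ∑ l ∈ Finset.range (t i + 1),
                        ((t i).choose l : ℂ) *
                          MTW.besselI (2 * (l : ℤ) - (t i : ℤ))
                            (((μ : ℂ) * (K : ℂ) * (Δ i : ℂ) * (γbar : ℂ) * s) /
                              ((μ : ℂ) * (1 + (K : ℂ)) - (γbar : ℂ) * s))) := by
  have hμR : (0 : ℝ) < μ := by exact_mod_cast hμ
  have : Nonempty (Fin μ) := ⟨⟨0, hμ⟩⟩
  obtain ⟨v, hv⟩ : ∃ v : NNReal, v = Real.toNNReal (σ ^ 2) := ⟨_, rfl⟩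
  have hvσ : (v : ℝ) = σ ^ 2 := by rw [hv, Real.coe_toNNReal _ (sq_nonneg σ)]
  have hv0 : v ≠ 0 := by
    have : (v : ℝ) ≠ 0 := by rw [hvσ]; positivity
    exact_mod_cast this
  have hvpos : (0 : ℝ) < v := by rw [hvσ]; positivity
  have hlaw := hasLaw_channelLaw hchan
  rw [← hv] at hlaw
  set c : ℝ := Es / N0 with hc
  have hcpos : 0 < c := div_pos hEs hN0
  obtain ⟨S, hS⟩ : ∃ S : ℝ, S = ∑ i, (V i 0 ^ 2 + V i 1 ^ 2) := ⟨_, rfl⟩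
  have hS0 : 0 ≤ S := by rw [hS]; positivity
  set W : Ω → ((Fin μ → ℝ) × (Fin μ → ℝ)) × ((Fin μ → ℝ) × (Fin μ → ℝ)) := fun ω =>
    ((fun i => φ i 0 ω, fun i => φ i 1 ω), (fun i => X i ω, fun i => Y i ω)) with hW
  have hγW (ω : Ω) : γ ω = c * totalPower V (W ω) := by
    rw [hγ, hc]
    simp only [MTW.snr, MTW.power, totalPower, specularAmplitude, MTW.clusterAmplitude, hW]
    ring
  have hcard : Fintype.card (Fin μ) = μ := Fintype.card_fin μ
  have hμK : 2 * v * (μ * K) = S := by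
    rw [hK, MTW.paramK, ← hS, hvσ]
    field_simp
  have hmean : γbar = c * (2 * v * (μ * (1 + K))) := by
    rw [hγbar]
    simp_rw [hγW]
    rw [integral_const_mul]
    have := hlaw.integral_comp (f := totalPower V)
      (continuous_totalPower V).aestronglyMeasurable
    rw [Function.comp_def] at this
    rw [this, integral_totalPower hv0, hcard, ← hS, ← hμK]
    ring
  have hK0 : 0 ≤ K := by
    rw [hK, MTW.paramK]; positivity
  have hK1 : 0 < 1 + K := by linarith
  set t : ℂ := c * s with ht
  -- Since the mean is `2vc · μ(1+K)`, the hypothesis on `s` is exactly this half-plane after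
  -- rescaling by `c`.
  have htre : t.re < 1 / (2 * v) := by
    rw [ht, Complex.re_ofReal_mul]
    rw [hmean] at hs
    have : (μ : ℝ) * (1 + K) / (c * (2 * v * (μ * (1 + K)))) = 1 / (2 * v) / c := by
      field_simp
    rw [this, lt_div_iff₀ hcpos] at hs
    linarith
  have hcont : Continuous fun w => (totalPower V w : ℂ) ^ n * Complex.exp (t * totalPower V w) := by
    have := continuous_totalPower V
    fun_prop
  have hfun : (fun ω => (γ ω : ℂ) ^ n * Complex.exp ((γ ω : ℂ) * s)) = fun ω => (c : ℂ) ^ n *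
      ((totalPower V (W ω) : ℂ) ^ n * Complex.exp (t * totalPower V (W ω))) := by
    funext ω
    rw [hγW, ht]
    push_cast
    rw [mul_pow, mul_assoc]
    congr 3
    ring
  have hD (j : Fin N) : S * Δ j = 2 * V (Fin.castLE hN j) 0 * V (Fin.castLE hN j) 1 := by
    rw [hΔ, MTW.paramDelta, ← hS]
    -- If `S = 0`, every amplitude vanishes and both sides are zero.
    rcases eq_or_ne S 0 with h0 | h0
    · have hz : ∀ i, V i 0 ^ 2 + V i 1 ^ 2 = 0 := fun i =>
        (Finset.sum_eq_zero_iff_of_nonneg fun i _ => by positivity).1 (hS ▸ h0) i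
          (Finset.mem_univ i)
      have : V (Fin.castLE hN j) 0 = 0 := by
        have := hz (Fin.castLE hN j)
        nlinarith [sq_nonneg (V (Fin.castLE hN j) 0), sq_nonneg (V (Fin.castLE hN j) 1)]
      simp [h0, this]
    · field_simp
  have hV0' : ∀ i ∉ Set.range (Fin.castLE hN), V i 0 = 0 ∨ V i 1 = 0 := fun i hi =>
    hV0 i (by
      by_contra hlt
      exact hi ⟨⟨i, by omega⟩, by simp⟩)
  have hint : Integrable
      (fun ω => (totalPower V (W ω) : ℂ) ^ n * Complex.exp (t * totalPower V (W ω))) P := by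
    have := (integral_totalPower_pow_mul_cexp_eq_integral_specularPower hv0 htre V n).1
    rw [← hlaw.map_eq] at this
    exact this.comp_aemeasurable hlaw.aemeasurable
  rw [MTW.generalizedMGF, hfun]
  refine ⟨hint.const_mul _, ?_⟩
  have hval := hlaw.integral_comp hcont.aestronglyMeasurable
  rw [Function.comp_def, integral_totalPower_pow_mul_cexp hv0 htre
    (Fin.castLE_injective hN) hV0' hS hD n, hcard] at hval
  rw [integral_const_mul, hval]
  obtain ⟨b, hb⟩ : ∃ b : ℂ, b = (μ : ℂ) * (1 + (K : ℂ)) := ⟨_, rfl⟩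
  have hb0 : b ≠ 0 := by
    rw [hb]; exact_mod_cast (mul_pos hμR hK1).ne'
  have hcC : (c : ℂ) ≠ 0 := by exact_mod_cast hcpos.ne'
  have hvC : (v : ℂ) ≠ 0 := by exact_mod_cast hv0
  have hγC : (γbar : ℂ) = c * (2 * v * b) := by rw [hb, hmean]; push_cast; rfl
  have hden : b - γbar * s = b * (1 - 2 * v * t) := by rw [hγC, ht]; ring
  have hSC : (S : ℂ) = 2 * v * (μ * K) := by rw [← hμK]; push_cast; rfl
  obtain ⟨u, hu⟩ : ∃ u : ℂ, u = (1 - 2 * (v : ℂ) * t)⁻¹ := ⟨_, rfl⟩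
  have hbu : (b - γbar * s)⁻¹ = b⁻¹ * u := by rw [hden, mul_inv, hu]
  have hγu : (γbar : ℂ) * s * (b⁻¹ * u) = 2 * v * t * u := by
    rw [hγC, ht]; field_simp
  rw [← hb, ← hu]
  have hexp : (μ : ℂ) * K * γbar * s / (b - γbar * s) = S * t * u := by
    rw [div_eq_mul_inv, hbu, hSC]
    linear_combination ((μ : ℂ) * K) * hγu
  have hz (j : Fin N) : (μ : ℂ) * K * Δ j * γbar * s / (b - γbar * s) = S * t * u * Δ j := by
    rw [← hexp]; ring
  simp_rw [hz]
  rw [hexp]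
  rw [Finset.mul_sum, Finset.mul_sum, Finset.mul_sum]
  refine Finset.sum_congr rfl fun q hq => ?_
  have hq' : q ≤ n := by simpa [Nat.lt_succ_iff] using hq
  generalize hZ : besselMoment (κ := Fin N) _ _ q = Z
  rw [besselMoment] at hZ
  rw [hZ, div_eq_mul_inv (b ^ _), ← inv_pow, hbu, hγC, hSC]
  obtain ⟨d, rfl⟩ := Nat.exists_eq_add_of_le hq'
  -- Here `n = q + d`. The surplus `b⁻ⁿ` is cancelled by the `bⁿ` in the `n`-th power of the mean,
  -- leaving `cⁿ (2v)ⁿ`, of which `(2v) ^ q` belongs to `S ^ q`.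
  have hp : b ^ (μ + q) * (b⁻¹ * u) ^ (μ + q + (q + d)) =
      u ^ (μ + q + (q + d)) * (b⁻¹) ^ (q + d) := by
    rw [mul_pow, pow_add b⁻¹ (μ + q), inv_pow, inv_pow]
    field_simp
  rw [hp, Nat.add_sub_cancel_left]
  have hp2 : (c * (2 * v * b)) ^ (q + d) * (b⁻¹) ^ (q + d) =
      c ^ (q + d) * (2 * (v : ℂ)) ^ (q + d) := by
    rw [← mul_pow, ← mul_pow]
    congr 1
    field_simp
  rw [mul_pow (2 * (v : ℂ)) (μ * K)]
  rw [pow_add (2 * (v : ℂ))] at hp2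
  linear_combination (-(Complex.Gamma (μ + (q + d : ℕ)) *
    Complex.exp (2 * v * (μ * K) * t * u) * ((q + d).choose q : ℂ) *
    ((μ * K) ^ q / Complex.Gamma (μ + q)) * u ^ (μ + q + (q + d)) * Z)) * hp2
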